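/- Theorem T (JH-algebra is JB-algebra). A real Jordan algebra is a real vector space $A$ with a commutative bilinear product $\bullet$ satisfying $x^2\bullet(x\bullet y)=x\bullet(x^2\bullet y)$, where $x^2:=x\bullet x$. A JH-algebra is a real Jordan algebra $A$ with an inner product $\langle\cdot,\cdot\rangle$ making it a Hilbert space such that $\langle x\bullet y,z\rangle=\langle y,x\bullet z\rangle$ for all $x,y,z\in A$. Let $A$ be a JH-algebra with unit $e$, and let $C=\{x^2 : x\in A\}$ be its set of squares; write $v\le w$ if $w-v\in C$. Then: 1. $(A,C,e)$ is an order unit space. That is, $C$ is convex, $\lambda C\subseteq C$ for all $\lambda\ge 0$, and $C\cap -C=\{0\}$; $C$ is Archimedean (if $v\in A$, $w\in C$ and $nv\le w$ for all $n\in\mathbb{N}$, then $v\le 0$); and $e\in C$ is an order unit (for each $v\in A$ there is $\lambda\ge 0$ with $-\lambda e\le v\le\lambda e$). 2. The order unit norm $\|v\|_e:=\inf\{\lambda\ge 0 : -\lambda e\le v\le \lambda e\}$ is equivalent to the Hilbert norm $\|v\|=\langle v,v\rangle^{1/2}$. 3. With the norm $\|\cdot\|_e$, the product $\bullet$ and the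 unit $e$, $A$ is a JB-algebra. That is, $\|\cdot\|_e$ is a complete norm on $A$ and, for all $x,y\in A$, $$\|x\bullet y\|_e\le\|x\|_e\|y\|_e,\qquad \|x^2\|_e=\|x\|_e^2,\qquad \|x^2\|_e\le\|x^2+y^2\|_e.$$ -/

import Mathlib

/-- A real Jordan algebra: a real vector space with a commutative bilinear product satisfying the
Jordan identity. Bilinearity is distributivity together with `IsScalarTower` and `SMulCommClass`.
Neither associativity nor a unit is assumed. -/
class RealJordanAlgebra (A : Type*) extends NonUnitalNonAssocCommRing A, Module ℝ A,
    IsScalarTower ℝ A A, SMulCommClass ℝ A A, IsCommJordan A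

/-- A JH-algebra: a real Jordan algebra with an inner product making it a Hilbert space, such that
`⟪x * y, z⟫ = ⟪y, x * z⟫` for all `x`, `y`, `z`. -/
class JHAlgebra (A : Type*) extends NormedAddCommGroup A, InnerProductSpace ℝ A, CompleteSpace A,
    RealJordanAlgebra A where
  inner_mul_left_eq : ∀ x y z : A, Inner.inner ℝ (x * y) z = Inner.inner ℝ y (x * z)

/-- `e` is a unit (identity element) of the algebra `A`. -/
def IsAlgUnit {A : Type*} [Mul A] (e : A) : Prop :=
  ∀ x : A, e * x = x ∧ x * e = x

/-- The set of squares. -/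
def squares (A : Type*) [Mul A] : Set A :=
  Set.range fun x : A => x * x

section OrderUnit

variable {V : Type*} [AddCommGroup V] [Module ℝ V]

/-- The relation `v ≤ w` induced by `C`. -/
def ConeLE (C : Set V) (v w : V) : Prop :=
  w - v ∈ C

/-- A (proper convex) cone in a real vector space. -/
structure IsProperCone (C : Set V) : Prop where
  convex : Convex ℝ C
  smul_mem : ∀ c : ℝ, 0 ≤ c → ∀ v ∈ C, c • v ∈ C
  inter_neg : C ∩ -C = {0}

/-- `C` is Archimedean: if `n v ≤ w` for all `n : ℕ`, where `w ∈ C`, then `v ≤ 0`. -/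
def IsArchimedeanCone (C : Set V) : Prop :=
  ∀ v : V, ∀ w ∈ C, (∀ n : ℕ, ConeLE C ((n : ℝ) • v) w) → ConeLE C v 0

/-- `u` is an order unit for `C`. -/
structure IsOrderUnit (C : Set V) (u : V) : Prop where
  mem : u ∈ C
  exists_bound : ∀ v : V, ∃ c : ℝ, 0 ≤ c ∧ ConeLE C (-(c • u)) v ∧ ConeLE C v (c • u)

/-- `(V, C, u)` is an order unit space. -/
structure IsOrderUnitSpace (C : Set V) (u : V) : Prop where
  isProperCone : IsProperCone C
  isArchimedeanCone : IsArchimedeanCone C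
  isOrderUnit : IsOrderUnit C u

/-- The order unit norm `inf {c ≥ 0 | -c u ≤ v ≤ c u}`. -/
noncomputable def orderUnitNorm (C : Set V) (u v : V) : ℝ :=
  sInf {c : ℝ | 0 ≤ c ∧ ConeLE C (-(c • u)) v ∧ ConeLE C v (c • u)}

/-- `N` is a norm on the real vector space `V`. -/
structure IsNormFun (N : V → ℝ) : Prop where
  nonneg : ∀ x, 0 ≤ N x
  eq_zero_iff : ∀ x, N x = 0 ↔ x = 0
  smul : ∀ (c : ℝ) (x : V), N (c • x) = |c| * N x
  add_le : ∀ x y, N (x + y) ≤ N x + N y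

/-- Every sequence that is Cauchy with respect to `N` converges with respect to `N`. -/
def IsCompleteFun (N : V → ℝ) : Prop :=
  ∀ u : ℕ → V,
    (∀ ε : ℝ, 0 < ε → ∃ n₀ : ℕ, ∀ m ≥ n₀, ∀ n ≥ n₀, N (u m - u n) < ε) →
    ∃ x : V, ∀ ε : ℝ, 0 < ε → ∃ n₀ : ℕ, ∀ n ≥ n₀, N (u n - x) < ε

/-- Two real-valued functions (norms) are equivalent. -/
def AreEquivalentNorms (N M : V → ℝ) : Prop :=
  ∃ a b : ℝ, 0 < a ∧ 0 < b ∧ ∀ x : V, N x ≤ a * M x ∧ M x ≤ b * N x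

end OrderUnit

/-- The real Jordan algebra `A`, with the element `e` as unit and the function `N` as norm,
is a (unital) JB-algebra. -/
structure IsJBAlgebra (A : Type*) [RealJordanAlgebra A] (e : A) (N : A → ℝ) : Prop where
  isAlgUnit : IsAlgUnit e
  isNorm : IsNormFun N
  isComplete : IsCompleteFun N
  norm_mul_le : ∀ x y : A, N (x * y) ≤ N x * N y
  norm_sq : ∀ x : A, N (x * x) = N x ^ 2
  norm_sq_le : ∀ x y : A, N (x * x) ≤ N (x * x + y * y)

/-! Everything rests on a finite spectral theorem (`exists_spectral_resolution`): each x is a finite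
real combination of orthogonal idempotents summing to e. By the Jordan identity the multiplication
operators of polynomials in x commute, so the closed span of the powers of x is an associative
algebra, on which L x is a bounded self-adjoint operator. An approximate eigenvalue c makes x - c·e
non-invertible there, and projecting the unit off the closed ideal it generates leaves a nonzero
idempotent p with x p = c p. Since ‖p‖ = ‖p p‖ ≤ K‖p‖², a nonzero idempotent has norm at least 1/K;
orthogonal idempotents are orthogonal vectors, so splitting them off exhausts ‖e‖² after finitely
many steps.

Idempotents have positive multiplication operators, hence v is a square iff ⟪v y, y⟫ ≥ 0 for all y
(`mem_squares_iff`). The order unit norm is therefore the numerical radius of L v, equal to the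
largest |coefficient| of v in a spectral resolution when e ≠ 0. The cone axioms, the norm
equivalence and the JB inequalities become statements about quadratic forms or real coefficients. -/

open scoped InnerProductSpace

/-! ### Jordan algebra identities and power associativity. -/

section Jordan

variable {A : Type*} [RealJordanAlgebra A]

theorem jordan_identity (a b : A) : a * a * (a * b) = a * (a * a * b) := by
  have h := IsCommJordan.lmul_comm_rmul_rmul a b
  rw [mul_comm (a * a) (a * b), h, mul_comm b]

theorem jordan_linearized_twice (x z y : A) :
    (2 : ℝ) • ((x * z) * (x * y)) + (x * x) * (z * y) =
      z * ((x * x) * y) + (2 : ℝ) • (x * ((x * z) * y)) := by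
  have h1 := jordan_identity (x + z) y
  have h2 := jordan_identity (x - z) y
  have h3 := jordan_identity z y
  simp only [add_mul, mul_add, sub_mul, mul_sub, mul_comm z x] at h1 h2
  have h4 : (2 : ℝ) • ((2 : ℝ) • ((x * z) * (x * y)) + (x * x) * (z * y)) =
      (2 : ℝ) • (z * ((x * x) * y) + (2 : ℝ) • (x * ((x * z) * y))) := by
    -- The difference at x + z and x - z is twice the part odd in z; removing the cubic term, which
    -- is the identity at z, leaves the part linear in z.
    linear_combination (norm := module) h1 - h2 - (2 : ℝ) • h3
  exact smul_right_injective A (two_ne_zero (α := ℝ)) h4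

theorem jordan_linearized (x w y z : A) :
    (x * y) * (w * z) + (w * y) * (x * z) + (x * w) * (y * z) =
      ((x * w) * y) * z + w * (y * (x * z)) + x * (y * (w * z)) := by
  have h1 := jordan_linearized_twice (x + w) z y
  have h2 := jordan_linearized_twice x z y
  have h3 := jordan_linearized_twice w z y
  simp only [add_mul, mul_add, mul_comm w x] at h1
  have h4 : (2 : ℝ) • ((x * y) * (w * z) + (w * y) * (x * z) + (x * w) * (y * z)) =
      (2 : ℝ) • (((x * w) * y) * z + w * (y * (x * z)) + x * (y * (w * z))) := by
    rw [mul_comm (x * y) (w * z), mul_comm (w * y) (x * z), mul_comm y z,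
      mul_comm ((x * w) * y) z, mul_comm y (x * z), mul_comm y (w * z)]
    linear_combination (norm := module) h1 - h2 - h3
  exact smul_right_injective A (two_ne_zero (α := ℝ)) h4

/-- The operator `L x` of multiplication by `x`. -/
noncomputable abbrev lmul (x : A) : Module.End ℝ A := LinearMap.mulLeft ℝ x

/-- Taking w to be a power of x gives a two-step recursion for the multiplication operators of
powers. -/
theorem lmul_mul_mul_self (x w : A) :
    lmul (x * (x * w)) = lmul (x * x) * lmul w + (2 : ℝ) • (lmul (x * w) * lmul x)
      - lmul w * lmul x * lmul x - lmul x * lmul x * lmul w := by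
  ext z
  have h := jordan_linearized x w x z
  simp only [LinearMap.sub_apply, LinearMap.add_apply, LinearMap.smul_apply, Module.End.mul_apply,
    LinearMap.mulLeft_apply]
  rw [mul_comm x (x * w)]
  rw [mul_comm w x] at h
  linear_combination (norm := module) -h

/-- The algebra of operators generated by `L x` and `L (x * x)`. -/
noncomputable def lmulAlgebra (x : A) : Subalgebra ℝ (Module.End ℝ A) :=
  Algebra.adjoin ℝ {lmul x, lmul (x * x)}

theorem commute_lmul_lmul_mul_self (x : A) : Commute (lmul x) (lmul (x * x)) :=
  LinearMap.ext fun z => (jordan_identity x z).symm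

theorem commute_of_mem_lmulAlgebra {x : A} {S T : Module.End ℝ A} (hS : S ∈ lmulAlgebra x)
    (hT : T ∈ lmulAlgebra x) : Commute S T := by
  have key : ∀ a ∈ ({lmul x, lmul (x * x)} : Set (Module.End ℝ A)),
      ∀ b ∈ ({lmul x, lmul (x * x)} : Set (Module.End ℝ A)), Commute a b := by
    rintro a (rfl | rfl) b (rfl | rfl)
    · exact Commute.refl _
    · exact commute_lmul_lmul_mul_self x
    · exact (commute_lmul_lmul_mul_self x).symm
    · exact Commute.refl _
  refine Algebra.commute_of_mem_adjoin_of_forall_mem_commute hT fun b hb => ?_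
  exact (Algebra.commute_of_mem_adjoin_of_forall_mem_commute hS
    fun a ha => key b hb a ha).symm

theorem lmul_pow_apply_mem {e : A} (he : IsAlgUnit e) (x : A) (n : ℕ) :
    lmul ((lmul x ^ n) e) ∈ lmulAlgebra x := by
  have hx : lmul x ∈ lmulAlgebra x := Algebra.subset_adjoin (by simp)
  have hxx : lmul (x * x) ∈ lmulAlgebra x := Algebra.subset_adjoin (by simp)
  induction n using Nat.twoStepInduction with
  | zero =>
    have : lmul e = 1 := LinearMap.ext fun z => (he z).1
    simp [this, one_mem]
  | one => simpa [(he x).2] using hx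
  | more n h1 h2 =>
    have h3 : (lmul x ^ (n + 2)) e = x * (x * (lmul x ^ n) e) := by
      simp [pow_succ', Module.End.mul_apply]
    have h4 : (lmul x ^ (n + 1)) e = x * (lmul x ^ n) e := by
      simp [pow_succ', Module.End.mul_apply]
    rw [h4] at h2
    rw [h3, lmul_mul_mul_self]
    exact sub_mem (sub_mem (add_mem (mul_mem hxx h1) ((lmulAlgebra x).smul_mem (mul_mem h2 hx) _))
      (mul_mem (mul_mem h1 hx) hx)) (mul_mem (mul_mem hx hx) h1)

/-- The span of the powers of `x`. -/
noncomputable def powerSpan (e x : A) : Submodule ℝ A :=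
  Submodule.span ℝ (Set.range fun n : ℕ => (lmul x ^ n) e)

theorem unit_mem_powerSpan (e x : A) : e ∈ powerSpan e x :=
  Submodule.subset_span ⟨0, by simp⟩

theorem self_mem_powerSpan {e : A} (he : IsAlgUnit e) (x : A) : x ∈ powerSpan e x :=
  Submodule.subset_span ⟨1, by simp [(he x).2]⟩

theorem lmul_mem_of_mem_powerSpan {e : A} (he : IsAlgUnit e) {x a : A} (ha : a ∈ powerSpan e x) :
    lmul a ∈ lmulAlgebra x := by
  have : powerSpan e x ≤ (lmulAlgebra x).toSubmodule.comap (LinearMap.mul ℝ A) := by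
    refine Submodule.span_le.2 ?_
    rintro _ ⟨n, rfl⟩
    exact lmul_pow_apply_mem he x n
  exact this ha

theorem powerSpan_mul_left_comm {e : A} (he : IsAlgUnit e) {x a b : A} (ha : a ∈ powerSpan e x)
    (hb : b ∈ powerSpan e x) (z : A) : a * (b * z) = b * (a * z) :=
  LinearMap.congr_fun (commute_of_mem_lmulAlgebra (lmul_mem_of_mem_powerSpan he ha)
    (lmul_mem_of_mem_powerSpan he hb)) z

/-- Since `lmul a` commutes with `lmul x`, a times the n-th power of x is `lmul x ^ n` applied to a
e = a. -/
theorem mul_mem_powerSpan {e : A} (he : IsAlgUnit e) {x a b : A} (ha : a ∈ powerSpan e x)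
    (hb : b ∈ powerSpan e x) : a * b ∈ powerSpan e x := by
  have key : ∀ n : ℕ, powerSpan e x ≤ (powerSpan e x).comap (lmul x ^ n) := by
    intro n
    refine Submodule.span_le.2 ?_
    rintro _ ⟨m, rfl⟩
    refine Submodule.subset_span ⟨n + m, ?_⟩
    simp [pow_add, Module.End.mul_apply]
  have : powerSpan e x ≤ (powerSpan e x).comap (lmul a) := by
    refine Submodule.span_le.2 ?_
    rintro _ ⟨n, rfl⟩
    have hx : lmul x ∈ lmulAlgebra x := Algebra.subset_adjoin (by simp)
    have h := LinearMap.congr_fun (commute_of_mem_lmulAlgebra (lmul_mem_of_mem_powerSpan he ha)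
      (pow_mem hx n)) e
    simp only [Module.End.mul_apply, LinearMap.mulLeft_apply, (he a).2] at h
    simp only [Submodule.comap_coe, Set.mem_preimage, LinearMap.mulLeft_apply, SetLike.mem_coe]
    rw [h]
    exact key n ha
  exact this hb

end Jordan

/-! ### Continuity of the product and idempotents from approximate eigenvalues. -/

section Hilbert

variable {A : Type*} [JHAlgebra A]

theorem inner_mul_left_comm (x y z : A) : ⟪x * y, z⟫_ℝ = ⟪y, x * z⟫_ℝ :=
  JHAlgebra.inner_mul_left_eq x y z

theorem lmul_isSymmetric (x : A) : (lmul x).IsSymmetric :=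
  fun y z => inner_mul_left_comm x y z

variable (A) in
-- Hellinger–Toeplitz bounds each L x because it is symmetric and everywhere defined; commutativity
-- makes the family over the unit ball pointwise bounded, so Banach–Steinhaus applies.
theorem exists_norm_mul_le : ∃ K : ℝ, 0 < K ∧ ∀ x y : A, ‖x * y‖ ≤ K * ‖x‖ * ‖y‖ := by
  let T : A → A →L[ℝ] A := fun x => ⟨lmul x, (lmul_isSymmetric x).continuous⟩
  have hT : ∀ x y, T x y = x * y := fun x y => rfl
  obtain ⟨C, hC⟩ := banach_steinhaus (g := fun x : Metric.closedBall (0 : A) 1 => T x) (by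
    intro y
    refine ⟨‖T y‖, fun x => ?_⟩
    rw [hT, mul_comm, ← hT]
    refine ((T y).le_opNorm _).trans ?_
    have := x.2
    rw [mem_closedBall_zero_iff] at this
    exact mul_le_of_le_one_right (norm_nonneg _) this)
  refine ⟨max C 1, by positivity, fun x y => ?_⟩
  rcases eq_or_ne x 0 with rfl | hx
  · simp
  have hx' : 0 < ‖x‖ := norm_pos_iff.2 hx
  have h1 : ‖‖x‖⁻¹ • x‖ = 1 := by
    rw [norm_smul, norm_inv, norm_norm, inv_mul_cancel₀ hx'.ne']
  have h2 := (T (‖x‖⁻¹ • x)).le_of_opNorm_le (hC ⟨‖x‖⁻¹ • x, by simp [h1]⟩) y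
  rw [hT, smul_mul_assoc, norm_smul, norm_inv, norm_norm, inv_mul_le_iff₀ hx'] at h2
  calc ‖x * y‖ ≤ ‖x‖ * (C * ‖y‖) := h2
    _ ≤ ‖x‖ * (max C 1 * ‖y‖) := by gcongr; exact le_max_left _ _
    _ = max C 1 * ‖x‖ * ‖y‖ := by ring

variable (A) in
theorem continuous_jhMul : Continuous fun p : A × A => p.1 * p.2 := by
  obtain ⟨K, -, hK⟩ := exists_norm_mul_le A
  exact ((LinearMap.mul ℝ A).mkContinuous₂ K hK).continuous₂

/-- A closed subalgebra whose multiplication operators commute; it is associative. -/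
structure IsClosedAssocSubalgebra (M : Submodule ℝ A) : Prop where
  isClosed : IsClosed (M : Set A)
  mul_mem : ∀ {a b : A}, a ∈ M → b ∈ M → a * b ∈ M
  mul_left_comm : ∀ {a b : A}, a ∈ M → b ∈ M → ∀ z : A, a * (b * z) = b * (a * z)

theorem IsClosedAssocSubalgebra.mul_assoc {M : Submodule ℝ A} (hM : IsClosedAssocSubalgebra M)
    {a b c : A} (ha : a ∈ M) (hc : c ∈ M) : a * b * c = a * (b * c) := by
  rw [mul_comm (a * b) c, hM.mul_left_comm hc ha, mul_comm c b]

theorem isClosedAssocSubalgebra_closure_powerSpan {e : A} (he : IsAlgUnit e) (x : A) :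
    IsClosedAssocSubalgebra (powerSpan e x).topologicalClosure where
  isClosed := Submodule.isClosed_topologicalClosure _
  mul_mem := fun ha hb =>
    map_mem_closure₂ (continuous_jhMul A) ha hb fun _ ha _ hb => mul_mem_powerSpan he ha hb
  mul_left_comm := by
    have hc := continuous_jhMul A
    intro a b ha hb z
    have hcl : IsClosed {p : A × A | p.1 * (p.2 * z) = p.2 * (p.1 * z)} := by
      refine isClosed_eq ?_ ?_
      · exact hc.comp (continuous_fst.prodMk
          (hc.comp (continuous_snd.prodMk continuous_const)))
      · exact hc.comp (continuous_snd.prodMk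
          (hc.comp (continuous_fst.prodMk continuous_const)))
    have hmem : (a, b) ∈ closure ((powerSpan e x : Set A) ×ˢ (powerSpan e x : Set A)) := by
      rw [closure_prod_eq]
      exact ⟨ha, hb⟩
    exact hcl.closure_subset_iff.2
      (fun p hp => powerSpan_mul_left_comm he hp.1 hp.2 z) hmem

/-- The orthogonal projection of the unit of an associative subalgebra to a closed ideal is
idempotent. -/
theorem starProjection_unit_mul_self {M I : Submodule ℝ A} [I.HasOrthogonalProjection] {q : A}
    (hIM : I ≤ M) (hI : ∀ a ∈ M, ∀ b ∈ I, a * b ∈ I)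
    (hunit : ∀ b ∈ M, q * b = b) :
    I.starProjection q * I.starProjection q = I.starProjection q := by
  set p := I.starProjection q
  have hp : p ∈ I := I.starProjection_apply_mem q
  have horth : ∀ b ∈ I, ⟪p, b⟫_ℝ = ⟪q, b⟫_ℝ := fun b hb => by
    have := Submodule.starProjection_inner_eq_zero (K := I) q b hb
    rw [inner_sub_left, sub_eq_zero] at this
    exact this.symm
  -- On I, p and q have the same inner products, so ⟪p p, b⟫ = ⟪p, p b⟫ = ⟪q, p b⟫ = ⟪p q, b⟫ = ⟪p,
  -- b⟫.
  have key : ∀ b ∈ I, ⟪p * p - p, b⟫_ℝ = 0 := fun b hb => by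
    have hpb : p * b ∈ I := hI p (hIM hp) b hb
    rw [inner_sub_left, inner_mul_left_comm, horth _ hpb, ← inner_mul_left_comm, mul_comm p q,
      hunit p (hIM hp), sub_self]
  exact sub_eq_zero.1 (inner_self_eq_zero.1
    (key _ (sub_mem (hI p (hIM hp) p hp) hp)))

/-- The supremum of the quadratic form of a bounded symmetric operator is an approximate
eigenvalue. -/
theorem exists_not_antilipschitz_sub {E : Type*} [NormedAddCommGroup E] [InnerProductSpace ℝ E]
    [CompleteSpace E] [Nontrivial E] {T : E →ₗ[ℝ] E} (hT : T.IsSymmetric) :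
    ∃ c : ℝ, ∀ δ : ℝ, 0 < δ → ∃ y : E, ‖T y - c • y‖ < δ * ‖y‖ := by
  have hcont : Continuous T := hT.continuous
  let T' : E →L[ℝ] E := ⟨T, hcont⟩
  have hTb : ∀ y, ‖T y‖ ≤ ‖T'‖ * ‖y‖ := T'.le_opNorm
  let R : Set ℝ := {r | ∃ y : E, ‖y‖ = 1 ∧ ⟪T y, y⟫_ℝ = r}
  have hR : BddAbove R := by
    refine ⟨‖T'‖, ?_⟩
    rintro _ ⟨y, hy, rfl⟩
    have h1 := real_inner_le_norm (T y) y
    have h2 := hTb y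
    rw [hy] at h1 h2
    linarith
  have hRne : R.Nonempty := by
    obtain ⟨y, hy⟩ := exists_norm_eq E zero_le_one
    exact ⟨_, y, hy, rfl⟩
  set c := sSup R
  obtain ⟨S, hS⟩ : ∃ S : E → E, ∀ y, S y = c • y - T y := ⟨_, fun _ => rfl⟩
  have hSpos : ∀ y, 0 ≤ ⟪S y, y⟫_ℝ := by
    intro y
    rcases eq_or_ne y 0 with rfl | hy
    · simp
    have hy' : 0 < ‖y‖ := norm_pos_iff.2 hy
    have h1 : ⟪T (‖y‖⁻¹ • y), ‖y‖⁻¹ • y⟫_ℝ ≤ c :=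
      le_csSup hR ⟨_, by rw [norm_smul, norm_inv, norm_norm, inv_mul_cancel₀ hy'.ne'], rfl⟩
    rw [map_smul, real_inner_smul_left, real_inner_smul_right, ← mul_assoc, ← mul_inv,
      inv_mul_le_iff₀ (by positivity)] at h1
    rw [hS, inner_sub_left, real_inner_smul_left, real_inner_self_eq_norm_mul_norm]
    linarith
  have hSadj : ∀ y z, ⟪S y, z⟫_ℝ = ⟪y, S z⟫_ℝ := by
    intro y z
    simp only [hS, inner_sub_left, inner_sub_right, real_inner_smul_left, real_inner_smul_right]
    rw [hT y z]
  set N := |c| + ‖T'‖ + 1 with hN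
  have hN0 : 0 < N := by positivity
  have hSN : ∀ y, ‖S y‖ ≤ N * ‖y‖ := by
    intro y
    rw [hS]
    refine (norm_sub_le _ _).trans ?_
    rw [norm_smul, Real.norm_eq_abs]
    nlinarith [hTb y, norm_nonneg y]
  have hCS : ∀ y, ‖S y‖ ^ 2 ≤ N * ⟪S y, y⟫_ℝ := by
    intro y
    -- Expanding positivity at this vector and using ⟪S (S y), S y⟫ ≤ N‖S y‖² yields the bound.
    have h1 := hSpos (N • y - S y)
    have h2 : S (N • y - S y) = N • S y - S (S y) := by
      simp only [hS, map_sub, map_smul]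
      module
    rw [h2, inner_sub_left, inner_sub_right, inner_sub_right, real_inner_smul_left,
      real_inner_smul_right, real_inner_smul_left, real_inner_smul_right, hSadj (S y) y,
      real_inner_self_eq_norm_mul_norm] at h1
    have h3 := real_inner_le_norm (S (S y)) (S y)
    have h4 : ‖S (S y)‖ * ‖S y‖ ≤ N * ‖S y‖ * ‖S y‖ := by gcongr; exact hSN _
    by_contra! h5
    nlinarith
  refine ⟨c, fun δ hδ => ?_⟩
  by_contra! hno
  have h1 : c ≤ c - δ ^ 2 / N := by
    refine csSup_le hRne ?_
    rintro _ ⟨y, hy, rfl⟩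
    have h2 := hno y
    have h3 := hCS y
    rw [hy, ← norm_neg, neg_sub, ← hS] at h2
    have h4 : δ ^ 2 ≤ N * ⟪S y, y⟫_ℝ := by
      refine le_trans ?_ h3
      have : δ ≤ ‖S y‖ := by simpa using h2
      gcongr
    have h5 : ⟪S y, y⟫_ℝ = c - ⟪T y, y⟫_ℝ := by
      rw [hS, inner_sub_left, real_inner_smul_left, real_inner_self_eq_norm_mul_norm, hy]
      ring
    have h6 : δ ^ 2 / N ≤ ⟪S y, y⟫_ℝ := by
      rw [div_le_iff₀ hN0]; linarith
    linarith
  have : 0 < δ ^ 2 / N := by positivity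
  linarith

/-- With c an approximate eigenvalue of L x on M and s = x - c q, the closed ideal generated by s is
proper; the component of q orthogonal to it is the required idempotent. -/
theorem IsClosedAssocSubalgebra.exists_idempotent_mul_eq_smul {M : Submodule ℝ A}
    (hM : IsClosedAssocSubalgebra M) {q x : A} (hq : q ∈ M) (hq0 : q ≠ 0)
    (hunit : ∀ b ∈ M, q * b = b) (hx : x ∈ M) :
    ∃ p ∈ M, p ≠ 0 ∧ p * p = p ∧ ∃ c : ℝ, x * p = c • p := by
  obtain ⟨K, hK0, hK⟩ := exists_norm_mul_le A
  have hcm := continuous_jhMul A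
  have : CompleteSpace M := hM.isClosed.completeSpace_coe
  have : Nontrivial M := ⟨⟨⟨q, hq⟩, 0, fun h => hq0 (congrArg Subtype.val h)⟩⟩
  let T : M →ₗ[ℝ] M := (lmul x).restrict fun b hb => hM.mul_mem hx hb
  have hT : T.IsSymmetric := fun y z => inner_mul_left_comm x y z
  obtain ⟨c, hc⟩ := exists_not_antilipschitz_sub hT
  set s : A := x - c • q with hs
  have hsM : s ∈ M := sub_mem hx (M.smul_mem c hq)
  have hsmul : ∀ b ∈ M, s * b = x * b - c • b := fun b hb => by
    rw [hs, sub_mul, smul_mul_assoc, hunit b hb]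
  let I : Submodule ℝ A := (M.map (lmul s)).topologicalClosure
  have hIcl : IsClosed (I : Set A) := Submodule.isClosed_topologicalClosure _
  have : CompleteSpace I := hIcl.completeSpace_coe
  have hIM : I ≤ M := by
    refine Submodule.topologicalClosure_minimal _ ?_ hM.isClosed
    rintro _ ⟨b, hb, rfl⟩
    exact hM.mul_mem hsM hb
  have hI : ∀ a ∈ M, ∀ b ∈ I, a * b ∈ I := by
    intro a ha b hb
    refine map_mem_closure (f := fun b => a * b)
      (hcm.comp (continuous_const.prodMk continuous_id)) hb ?_
    rintro _ ⟨d, hd, rfl⟩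
    exact ⟨a * d, hM.mul_mem ha hd, hM.mul_left_comm hsM ha d⟩
  set r := I.starProjection q
  have hrI : r ∈ I := I.starProjection_apply_mem q
  have hrM : r ∈ M := hIM hrI
  have hrr : r * r = r := starProjection_unit_mul_self hIM hI hunit
  refine ⟨q - r, sub_mem hq hrM, ?_, ?_, c, ?_⟩
  · intro hqr
    rw [sub_eq_zero] at hqr
    have hqI : q ∈ closure ((M.map (lmul s) : Submodule ℝ A) : Set A) := by
      have := hrI
      rw [← hqr] at this
      exact this
    -- If q were in the ideal, b would nearly invert s. The constants make both terms of y = (q - s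
    -- b) y + b (s y) at most ‖y‖/2, the second strictly: a contradiction.
    obtain ⟨_, ⟨b, hb, rfl⟩, hbq⟩ := Metric.mem_closure_iff.1 hqI (1 / (2 * K)) (by positivity)
    rw [dist_eq_norm, LinearMap.mulLeft_apply] at hbq
    obtain ⟨y, hy⟩ := hc (1 / (2 * K * (‖b‖ + 1))) (by positivity)
    have hyM : (y : A) ∈ M := y.2
    have h1 : ‖s * (y : A)‖ < 1 / (2 * K * (‖b‖ + 1)) * ‖(y : A)‖ := by
      rw [hsmul _ hyM]
      exact hy
    have hy0 : 0 < ‖(y : A)‖ := by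
      by_contra! h
      have h' : ‖(y : A)‖ = 0 := le_antisymm h (norm_nonneg _)
      rw [h', mul_zero] at h1
      exact absurd h1 (not_lt.2 (norm_nonneg _))
    have h2 : (q - s * b) * (y : A) = y - b * (s * y) := by
      rw [sub_mul, hunit _ hyM, mul_comm s b, hM.mul_assoc hb hyM]
    have h3 : ‖(y : A) - b * (s * y)‖ ≤ K * (1 / (2 * K)) * ‖(y : A)‖ := by
      rw [← h2]
      refine (hK _ _).trans ?_
      gcongr
    have h4 : ‖b * (s * (y : A))‖ < K * (‖b‖ + 1) * (1 / (2 * K * (‖b‖ + 1)) * ‖(y : A)‖) := by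
      refine (hK _ _).trans_lt ?_
      have hb1 : ‖b‖ ≤ ‖b‖ + 1 := by linarith
      calc K * ‖b‖ * ‖s * (y : A)‖ ≤ K * (‖b‖ + 1) * ‖s * (y : A)‖ := by gcongr
        _ < _ := by gcongr
    have h5 := norm_sub_norm_le (y : A) (b * (s * y))
    have h6 : K * (1 / (2 * K)) * ‖(y : A)‖ = ‖(y : A)‖ / 2 := by field_simp
    have h7 : K * (‖b‖ + 1) * (1 / (2 * K * (‖b‖ + 1)) * ‖(y : A)‖) = ‖(y : A)‖ / 2 := by
      field_simp
    rw [h6] at h3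
    rw [h7] at h4
    linarith
  · rw [mul_sub, sub_mul, sub_mul, hunit q hq, hunit r hrM, mul_comm r q, hunit r hrM, hrr]
    abel
  · have hw : q - r ∈ M := sub_mem hq hrM
    -- With w = q - r orthogonal to I, ‖s w‖² = ⟪w, s (s w)⟫ = 0.
    have h1 : s * (q - r) = 0 := by
      have h2 : s * (s * (q - r)) ∈ I :=
        Submodule.le_topologicalClosure _ ⟨_, hM.mul_mem hsM hw, rfl⟩
      have h3 := Submodule.starProjection_inner_eq_zero (K := I) q _ h2
      rw [← inner_mul_left_comm] at h3
      exact inner_self_eq_zero.1 h3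
    rw [hsmul _ hw] at h1
    exact sub_eq_zero.1 h1

end Hilbert

/-! ### Finite spectral resolutions and positivity. -/

section Spectral

variable {A : Type*} [JHAlgebra A]

/-- The Peirce equation 2L³ - 3L² + L = 0 for L = L p confines its eigenvalues to 0, 1/2, 1. The
proof pairs it with y and L y and uses ‖L y - L² y‖² ≥ 0, avoiding the decomposition. -/
theorem inner_idempotent_mul_nonneg {p : A} (hp : p * p = p) (y : A) : 0 ≤ ⟪p * y, y⟫_ℝ := by
  have h1 := jordan_linearized p p p y
  rw [hp, hp] at h1
  have h2 : (3 : ℝ) • (p * (p * y)) = p * y + (2 : ℝ) • (p * (p * (p * y))) := by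
    linear_combination (norm := module) h1
  have h3 := congrArg (fun z => ⟪z, y⟫_ℝ) h2
  have h4 := congrArg (fun z => ⟪z, p * y⟫_ℝ) h2
  simp only [inner_add_left, real_inner_smul_left, inner_mul_left_comm p _ y] at h3
  simp only [inner_add_left, real_inner_smul_left] at h4
  have h5 : ⟪p * (p * (p * y)), p * y⟫_ℝ = ⟪p * (p * y), p * (p * y)⟫_ℝ :=
    inner_mul_left_comm p (p * (p * y)) (p * y)
  have h6 : 0 ≤ ⟪p * y - p * (p * y), p * y - p * (p * y)⟫_ℝ := real_inner_self_nonneg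
  have h7 : 0 ≤ ⟪p * y, p * y⟫_ℝ := real_inner_self_nonneg
  rw [real_inner_sub_sub_self] at h6
  have h8 := real_inner_comm (p * y) (p * (p * y))
  rw [inner_mul_left_comm p y y]
  linarith

/-- The integer n bounds the number of splittings: removing p from q lowers K²‖q‖² by K²‖p‖² ≥ 1. -/
theorem IsClosedAssocSubalgebra.exists_orthogonal_idempotents {M : Submodule ℝ A}
    (hM : IsClosedAssocSubalgebra M) {x : A} (hx : x ∈ M) {K : ℝ} (hK0 : 0 < K)
    (hK : ∀ a b : A, ‖a * b‖ ≤ K * ‖a‖ * ‖b‖) (n : ℕ) :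
    ∀ q ∈ M, q * q = q → K ^ 2 * ‖q‖ ^ 2 ≤ n → ∃ s : Finset A,
      (∀ p ∈ s, p ∈ M ∧ p ≠ 0 ∧ p * p = p ∧ q * p = p ∧ ∃ c : ℝ, x * p = c • p) ∧
      (∀ p ∈ s, ∀ r ∈ s, p ≠ r → p * r = 0) ∧ ∑ p ∈ s, p = q := by
  classical
  induction n with
  | zero =>
    intro q _ _ hn
    have : q = 0 := by
      by_contra h
      have : 0 < ‖q‖ := norm_pos_iff.2 h
      have : 0 < K ^ 2 * ‖q‖ ^ 2 := by positivity
      push_cast at hn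
      linarith
    exact ⟨∅, by simp, by simp, by simp [this]⟩
  | succ n ih =>
    intro q hq hqq hn
    rcases eq_or_ne q 0 with rfl | hq0
    · exact ⟨∅, by simp, by simp, by simp⟩
    -- The corner of M on which q acts as the unit.
    let N : Submodule ℝ A := M ⊓ LinearMap.eqLocus (lmul q) LinearMap.id
    have hN : IsClosedAssocSubalgebra N :=
      { isClosed := by
          refine hM.isClosed.inter (isClosed_eq (lmul_isSymmetric q).continuous continuous_id)
        mul_mem := fun {a b} ha hb => ⟨hM.mul_mem ha.1 hb.1, by
          have h1 : q * b = b := hb.2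
          change q * (a * b) = a * b
          rw [hM.mul_left_comm hq ha.1, h1]⟩
        mul_left_comm := fun ha hb => hM.mul_left_comm ha.1 hb.1 }
    have hxN : q * x ∈ N := ⟨hM.mul_mem hq hx, by
      change q * (q * x) = q * x
      rw [← hM.mul_assoc hq hx, hqq]⟩
    obtain ⟨p, hpN, hp0, hpp, c, hc⟩ :=
      hN.exists_idempotent_mul_eq_smul (q := q) ⟨hq, hqq⟩ hq0 (fun b hb => hb.2) hxN
    have hpM : p ∈ M := hpN.1
    have hqp : q * p = p := hpN.2
    have hxp : x * p = c • p := by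
      rw [← hc, mul_comm q x, hM.mul_assoc hx hpM, hqp]
    have hd : (q - p) * (q - p) = q - p := by
      rw [mul_sub, sub_mul, sub_mul, mul_comm p q, hqq, hqp, hpp]
      abel
    have hpd : p * (q - p) = 0 := by rw [mul_sub, mul_comm p q, hqp, hpp, sub_self]
    have hp1 : 1 ≤ K * ‖p‖ := by
      have h := hK p p
      rw [hpp] at h
      have : 0 < ‖p‖ := norm_pos_iff.2 hp0
      nlinarith
    have hnorm : ‖q - p‖ ^ 2 = ‖q‖ ^ 2 - ‖p‖ ^ 2 := by
      have h1 : ⟪q, p⟫_ℝ = ‖p‖ ^ 2 := by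
        rw [← real_inner_self_eq_norm_sq]
        conv_lhs => rw [← hpp, ← inner_mul_left_comm, mul_comm p q, hqp]
      rw [norm_sub_sq_real, h1]
      ring
    obtain ⟨s, hs1, hs2, hs3⟩ := ih (q - p) (sub_mem hq hpM) hd (by
      rw [hnorm]
      push_cast at hn
      nlinarith)
    have hpr : ∀ r ∈ s, p * r = 0 := fun r hr => by
      rw [← (hs1 r hr).2.2.2.1, ← hM.mul_assoc hpM (hs1 r hr).1, hpd, zero_mul]
    have hps : p ∉ s := fun h => hp0 (by rw [← hpp, hpr p h])
    refine ⟨insert p s, ?_, ?_, ?_⟩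
    · intro r hr
      rcases Finset.mem_insert.1 hr with rfl | hr
      · exact ⟨hpM, hp0, hpp, hqp, c, hxp⟩
      · obtain ⟨h0, h1, h2, h3, h4⟩ := hs1 r hr
        refine ⟨h0, h1, h2, ?_, h4⟩
        rw [sub_mul, hpr r hr, sub_zero] at h3
        exact h3
    · intro r hr t ht hrt
      rcases Finset.mem_insert.1 hr with hr' | hr' <;> rcases Finset.mem_insert.1 ht with ht' | ht'
      · exact absurd (hr'.trans ht'.symm) hrt
      · rw [hr', hpr t ht']
      · rw [ht', mul_comm, hpr r hr']
      · exact hs2 r hr' t ht' hrt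
    · rw [Finset.sum_insert hps, hs3]
      abel

/-- A finite family of nonzero orthogonal idempotents with sum `e`. -/
structure IsOrthogonalResolution (e : A) (s : Finset A) : Prop where
  ne_zero : ∀ p ∈ s, p ≠ 0
  mul_self : ∀ p ∈ s, p * p = p
  mul_eq_zero : ∀ p ∈ s, ∀ r ∈ s, p ≠ r → p * r = 0
  sum_eq : ∑ p ∈ s, p = e

theorem exists_spectral_resolution {e : A} (he : IsAlgUnit e) (x : A) :
    ∃ s : Finset A, IsOrthogonalResolution e s ∧ ∃ f : A → ℝ, x = ∑ p ∈ s, f p • p := by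
  obtain ⟨K, hK0, hK⟩ := exists_norm_mul_le A
  have hM := isClosedAssocSubalgebra_closure_powerSpan he x
  obtain ⟨n, hn⟩ := exists_nat_ge (K ^ 2 * ‖e‖ ^ 2)
  obtain ⟨s, hs1, hs2, hs3⟩ := hM.exists_orthogonal_idempotents
    (Submodule.le_topologicalClosure _ (self_mem_powerSpan he x)) hK0 hK n e
    (Submodule.le_topologicalClosure _ (unit_mem_powerSpan e x)) (he e).1 hn
  choose! f hf using fun p hp => (hs1 p hp).2.2.2.2
  refine ⟨s, ⟨fun p hp => (hs1 p hp).2.1, fun p hp => (hs1 p hp).2.2.1, hs2, hs3⟩, f, ?_⟩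
  rw [← Finset.sum_congr rfl hf, ← Finset.mul_sum, hs3, (he x).2]

namespace IsOrthogonalResolution

variable {e : A} {s : Finset A}

theorem sum_mul_idempotent (hs : IsOrthogonalResolution e s) (f : A → ℝ) {p : A} (hp : p ∈ s) :
    (∑ r ∈ s, f r • r) * p = f p • p := by
  rw [Finset.sum_mul, Finset.sum_eq_single_of_mem p hp, smul_mul_assoc, hs.mul_self p hp]
  intro r hr hrp
  rw [smul_mul_assoc, hs.mul_eq_zero r hr p hp hrp, smul_zero]

theorem sum_mul_sum (hs : IsOrthogonalResolution e s) (f g : A → ℝ) :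
    (∑ p ∈ s, f p • p) * (∑ p ∈ s, g p • p) = ∑ p ∈ s, (f p * g p) • p := by
  rw [Finset.mul_sum]
  refine Finset.sum_congr rfl fun p hp => ?_
  rw [mul_smul_comm, hs.sum_mul_idempotent f hp, smul_smul, mul_comm]

theorem sum_smul_mem_squares (hs : IsOrthogonalResolution e s) {f : A → ℝ}
    (hf : ∀ p ∈ s, 0 ≤ f p) : ∑ p ∈ s, f p • p ∈ squares A := by
  refine ⟨∑ p ∈ s, √(f p) • p, ?_⟩
  simp only
  rw [hs.sum_mul_sum]
  exact Finset.sum_congr rfl fun p hp => by rw [Real.mul_self_sqrt (hf p hp)]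

theorem nonneg_of_inner_nonneg (hs : IsOrthogonalResolution e s) {f : A → ℝ}
    (h : ∀ y, 0 ≤ ⟪(∑ p ∈ s, f p • p) * y, y⟫_ℝ) {p : A} (hp : p ∈ s) : 0 ≤ f p := by
  have h1 := h p
  rw [hs.sum_mul_idempotent f hp, real_inner_smul_left, real_inner_self_eq_norm_sq] at h1
  have h2 : 0 < ‖p‖ := norm_pos_iff.2 (hs.ne_zero p hp)
  exact nonneg_of_mul_nonneg_left h1 (by positivity)

end IsOrthogonalResolution

theorem mem_squares_iff {e : A} (he : IsAlgUnit e) (v : A) :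
    v ∈ squares A ↔ ∀ y, 0 ≤ ⟪v * y, y⟫_ℝ := by
  constructor
  · rintro ⟨x, rfl⟩ y
    obtain ⟨s, hs, f, rfl⟩ := exists_spectral_resolution he x
    simp only
    rw [hs.sum_mul_sum, Finset.sum_mul, sum_inner]
    refine Finset.sum_nonneg fun p hp => ?_
    rw [smul_mul_assoc, real_inner_smul_left]
    exact mul_nonneg (mul_self_nonneg _) (inner_idempotent_mul_nonneg (hs.mul_self p hp) y)
  · intro h
    obtain ⟨s, hs, f, rfl⟩ := exists_spectral_resolution he v
    exact hs.sum_smul_mem_squares fun p hp => hs.nonneg_of_inner_nonneg h hp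

theorem IsOrthogonalResolution.sum_smul_mem_squares_iff {e : A} {s : Finset A} (he : IsAlgUnit e)
    (hs : IsOrthogonalResolution e s) (f : A → ℝ) :
    ∑ p ∈ s, f p • p ∈ squares A ↔ ∀ p ∈ s, 0 ≤ f p :=
  ⟨fun h _ hp => hs.nonneg_of_inner_nonneg ((mem_squares_iff he _).1 h) hp,
    hs.sum_smul_mem_squares⟩

theorem order_interval_iff {e : A} (he : IsAlgUnit e) (c : ℝ) (v : A) :
    ConeLE (squares A) (-(c • e)) v ∧ ConeLE (squares A) v (c • e) ↔
      ∀ y, |⟪v * y, y⟫_ℝ| ≤ c * ‖y‖ ^ 2 := by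
  have he' : ∀ y, e * y = y := fun y => (he y).1
  simp only [ConeLE, mem_squares_iff he, ← forall_and]
  refine forall_congr' fun y => ?_
  rw [abs_le, sub_neg_eq_add, add_mul, sub_mul, smul_mul_assoc, he', inner_add_left,
    inner_sub_left, real_inner_smul_left, real_inner_self_eq_norm_sq]
  constructor <;> rintro ⟨h1, h2⟩ <;> constructor <;> linarith

theorem IsOrthogonalResolution.forall_abs_inner_le_iff {e : A} {s : Finset A} (he : IsAlgUnit e)
    (hs : IsOrthogonalResolution e s) (f : A → ℝ) (c : ℝ) :
    (∀ y, |⟪(∑ p ∈ s, f p • p) * y, y⟫_ℝ| ≤ c * ‖y‖ ^ 2) ↔ ∀ p ∈ s, |f p| ≤ c := by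
  have h1 : c • e + ∑ p ∈ s, f p • p = ∑ p ∈ s, (c + f p) • p := by
    rw [← hs.sum_eq, Finset.smul_sum, ← Finset.sum_add_distrib]
    exact Finset.sum_congr rfl fun p _ => (add_smul _ _ _).symm
  have h2 : c • e - ∑ p ∈ s, f p • p = ∑ p ∈ s, (c - f p) • p := by
    rw [← hs.sum_eq, Finset.smul_sum, ← Finset.sum_sub_distrib]
    exact Finset.sum_congr rfl fun p _ => (sub_smul _ _ _).symm
  rw [← order_interval_iff he, ConeLE, ConeLE, sub_neg_eq_add, add_comm, h1, h2,
    hs.sum_smul_mem_squares_iff he, hs.sum_smul_mem_squares_iff he, ← forall₂_and]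
  refine forall₂_congr fun p _ => ?_
  rw [abs_le]
  constructor <;> rintro ⟨h3, h4⟩ <;> constructor <;> linarith

/-- One resolution serves both v and v², with coefficients f p and (f p)²; both sides say |f p| ≤ c.
-/
theorem forall_abs_inner_mul_self_le_iff {e : A} (he : IsAlgUnit e) (v : A) {c : ℝ} (hc : 0 ≤ c) :
    (∀ y, |⟪v * v * y, y⟫_ℝ| ≤ c ^ 2 * ‖y‖ ^ 2) ↔ ∀ y, |⟪v * y, y⟫_ℝ| ≤ c * ‖y‖ ^ 2 := by
  obtain ⟨s, hs, f, rfl⟩ := exists_spectral_resolution he v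
  rw [hs.sum_mul_sum, hs.forall_abs_inner_le_iff he, hs.forall_abs_inner_le_iff he]
  refine forall₂_congr fun p _ => ?_
  rw [abs_mul_self, ← sq, sq_le_sq, abs_of_nonneg hc]

end Spectral

/-! ### The order unit space, its norm and the JB axioms. -/

section OrderUnitNorm

variable {A : Type*} [JHAlgebra A] {e : A}

theorem isOrderUnit_squares (he : IsAlgUnit e) : IsOrderUnit (squares A) e where
  mem := ⟨e, (he e).1⟩
  exists_bound v := by
    obtain ⟨K, hK0, hK⟩ := exists_norm_mul_le A
    refine ⟨K * ‖v‖, by positivity, (order_interval_iff he _ v).2 fun y => ?_⟩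
    calc |⟪v * y, y⟫_ℝ| ≤ ‖v * y‖ * ‖y‖ := abs_real_inner_le_norm _ _
      _ ≤ K * ‖v‖ * ‖y‖ * ‖y‖ := by gcongr; exact hK v y
      _ = K * ‖v‖ * ‖y‖ ^ 2 := by ring

theorem isProperCone_squares (he : IsAlgUnit e) : IsProperCone (squares A) where
  convex := by
    intro v hv w hw a b ha hb _
    rw [mem_squares_iff he] at hv hw ⊢
    intro y
    rw [add_mul, smul_mul_assoc, smul_mul_assoc, inner_add_left, real_inner_smul_left,
      real_inner_smul_left]
    exact add_nonneg (mul_nonneg ha (hv y)) (mul_nonneg hb (hw y))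
  smul_mem c hc v hv := by
    rw [mem_squares_iff he] at hv ⊢
    intro y
    rw [smul_mul_assoc, real_inner_smul_left]
    exact mul_nonneg hc (hv y)
  inter_neg := by
    ext v
    constructor
    · rintro ⟨h1, h2⟩
      have h3 : ∀ y, |⟪v * y, y⟫_ℝ| ≤ 0 * ‖y‖ ^ 2 :=
        (order_interval_iff he 0 v).1 ⟨by simpa [ConeLE] using h1, by simpa [ConeLE] using h2⟩
      -- At y = e the form of v² is ‖v‖², which must vanish.
      have h4 := (forall_abs_inner_mul_self_le_iff he v le_rfl).2 h3 e
      rw [(he (v * v)).2, inner_mul_left_comm, (he v).2] at h4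
      simpa using h4
    · rintro rfl
      have h0 : (0 : A) ∈ squares A := ⟨0, mul_zero 0⟩
      exact ⟨h0, by simpa using h0⟩

theorem isArchimedeanCone_squares (he : IsAlgUnit e) : IsArchimedeanCone (squares A) := by
  intro v w _ h
  simp only [ConeLE, mem_squares_iff he] at h ⊢
  intro y
  simp only [sub_mul, smul_mul_assoc, inner_sub_left, real_inner_smul_left, zero_sub,
    sub_nonneg, neg_mul, inner_neg_left, neg_nonneg] at h ⊢
  by_contra! hlt
  obtain ⟨n, hn⟩ := exists_nat_gt (⟪w * y, y⟫_ℝ / ⟪v * y, y⟫_ℝ)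
  rw [div_lt_iff₀ hlt] at hn
  exact absurd (h n y) (not_le.2 hn)

theorem orderUnitNorm_nonneg (C : Set A) (e v : A) : 0 ≤ orderUnitNorm C e v :=
  Real.sInf_nonneg fun _ h => h.1

/-- The infimum is attained, since each Rayleigh quotient is a lower bound for the admissible
constants. -/
theorem orderUnitNorm_squares_le_iff (he : IsAlgUnit e) (v : A) {c : ℝ} (hc : 0 ≤ c) :
    orderUnitNorm (squares A) e v ≤ c ↔ ∀ y, |⟪v * y, y⟫_ℝ| ≤ c * ‖y‖ ^ 2 := by
  constructor
  · intro h y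
    refine le_trans ?_ (mul_le_mul_of_nonneg_right h (sq_nonneg _))
    rcases eq_or_ne y 0 with rfl | hy
    · simp
    have hy' : 0 < ‖y‖ := norm_pos_iff.2 hy
    rw [← div_le_iff₀ (by positivity)]
    refine le_csInf ((isOrderUnit_squares he).exists_bound v) fun b hb => ?_
    rw [div_le_iff₀ (by positivity)]
    exact (order_interval_iff he b v).1 hb.2 y
  · intro h
    exact csInf_le ⟨0, fun _ h => h.1⟩ ⟨hc, (order_interval_iff he c v).2 h⟩

theorem abs_inner_mul_le (he : IsAlgUnit e) (v y : A) :
    |⟪v * y, y⟫_ℝ| ≤ orderUnitNorm (squares A) e v * ‖y‖ ^ 2 :=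
  (orderUnitNorm_squares_le_iff he v (orderUnitNorm_nonneg _ _ _)).1 le_rfl y

/-- Evaluate the form of v² at e: ‖v‖² = ⟪v² e, e⟫. -/
theorem norm_le_orderUnitNorm (he : IsAlgUnit e) (v : A) :
    ‖v‖ ≤ ‖e‖ * orderUnitNorm (squares A) e v := by
  have h0 := orderUnitNorm_nonneg (squares A) e v
  have h := (forall_abs_inner_mul_self_le_iff he v h0).2 (abs_inner_mul_le he v) e
  rw [(he (v * v)).2, inner_mul_left_comm, (he v).2, real_inner_self_eq_norm_sq,
    abs_of_nonneg (sq_nonneg _), ← mul_pow, sq_le_sq, abs_norm, abs_of_nonneg (by positivity)] at h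
  linarith

theorem orderUnitNorm_le_norm (he : IsAlgUnit e) :
    ∃ K : ℝ, 0 < K ∧ ∀ v, orderUnitNorm (squares A) e v ≤ K * ‖v‖ := by
  obtain ⟨K, hK0, hK⟩ := exists_norm_mul_le A
  refine ⟨K, hK0, fun v => (orderUnitNorm_squares_le_iff he v (by positivity)).2 fun y => ?_⟩
  calc |⟪v * y, y⟫_ℝ| ≤ ‖v * y‖ * ‖y‖ := abs_real_inner_le_norm _ _
    _ ≤ K * ‖v‖ * ‖y‖ * ‖y‖ := by gcongr; exact hK v y
    _ = K * ‖v‖ * ‖y‖ ^ 2 := by ring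

theorem areEquivalentNorms_orderUnitNorm (he : IsAlgUnit e) :
    AreEquivalentNorms (orderUnitNorm (squares A) e) (fun x : A => ‖x‖) := by
  obtain ⟨K, hK0, hK⟩ := orderUnitNorm_le_norm he
  refine ⟨K, ‖e‖ + 1, hK0, by positivity, fun x => ⟨hK x, ?_⟩⟩
  have := orderUnitNorm_nonneg (squares A) e x
  exact (norm_le_orderUnitNorm he x).trans (by gcongr; linarith)

theorem isNormFun_orderUnitNorm (he : IsAlgUnit e) :
    IsNormFun (orderUnitNorm (squares A) e) := by
  have h0 := orderUnitNorm_nonneg (squares A) e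
  have hsmul : ∀ (c : ℝ) (x : A),
      orderUnitNorm (squares A) e (c • x) ≤ |c| * orderUnitNorm (squares A) e x := by
    intro c x
    refine (orderUnitNorm_squares_le_iff he _ (mul_nonneg (abs_nonneg c) (h0 x))).2 fun y => ?_
    rw [smul_mul_assoc, real_inner_smul_left, abs_mul, mul_assoc]
    exact mul_le_mul_of_nonneg_left (abs_inner_mul_le he x y) (abs_nonneg c)
  refine ⟨h0, fun x => ⟨fun h => ?_, ?_⟩, fun c x => le_antisymm (hsmul c x) ?_, fun x y => ?_⟩
  · have h1 := norm_le_orderUnitNorm he x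
    rw [h, mul_zero] at h1
    exact norm_le_zero_iff.1 h1
  · rintro rfl
    have := hsmul 0 0
    rw [zero_smul, abs_zero, zero_mul] at this
    exact le_antisymm this (h0 0)
  · rcases eq_or_ne c 0 with rfl | hc
    · simpa using h0 (0 : A)
    have h1 := hsmul c⁻¹ (c • x)
    rw [smul_smul, inv_mul_cancel₀ hc, one_smul, abs_inv] at h1
    have hc' : 0 < |c| := abs_pos.2 hc
    rwa [le_inv_mul_iff₀ hc'] at h1
  · refine (orderUnitNorm_squares_le_iff he _ (add_nonneg (h0 x) (h0 y))).2 fun z => ?_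
    rw [add_mul, inner_add_left, add_mul]
    exact (abs_add_le _ _).trans (add_le_add (abs_inner_mul_le he x z) (abs_inner_mul_le he y z))

theorem isCompleteFun_orderUnitNorm (he : IsAlgUnit e) :
    IsCompleteFun (orderUnitNorm (squares A) e) := by
  obtain ⟨a, b, ha, hb, hab⟩ := areEquivalentNorms_orderUnitNorm he
  intro u hu
  have hcau : CauchySeq u := by
    refine Metric.cauchySeq_iff.2 fun ε hε => ?_
    obtain ⟨n₀, hn₀⟩ := hu (ε / b) (by positivity)
    refine ⟨n₀, fun m hm n hn => ?_⟩
    rw [dist_eq_norm]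
    refine (hab _).2.trans_lt ?_
    have := hn₀ m hm n hn
    rwa [lt_div_iff₀' hb] at this
  obtain ⟨x, hx⟩ := cauchySeq_tendsto_of_complete hcau
  refine ⟨x, fun ε hε => ?_⟩
  obtain ⟨n₀, hn₀⟩ := Metric.tendsto_atTop.1 hx (ε / a) (by positivity)
  refine ⟨n₀, fun n hn => (hab _).1.trans_lt ?_⟩
  have := hn₀ n hn
  rwa [dist_eq_norm, lt_div_iff₀' ha] at this

theorem orderUnitNorm_mul_self (he : IsAlgUnit e) (x : A) :
    orderUnitNorm (squares A) e (x * x) = orderUnitNorm (squares A) e x ^ 2 := by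
  have h0 := orderUnitNorm_nonneg (squares A) e
  refine le_antisymm ?_ ?_
  · exact (orderUnitNorm_squares_le_iff he _ (sq_nonneg _)).2
      ((forall_abs_inner_mul_self_le_iff he x (h0 x)).2 (abs_inner_mul_le he x))
  · have h1 : orderUnitNorm (squares A) e x ≤ √(orderUnitNorm (squares A) e (x * x)) := by
      refine (orderUnitNorm_squares_le_iff he _ (Real.sqrt_nonneg _)).2
        ((forall_abs_inner_mul_self_le_iff he x (Real.sqrt_nonneg _)).1 ?_)
      rw [Real.sq_sqrt (h0 _)]
      exact abs_inner_mul_le he (x * x)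
    exact (Real.le_sqrt (h0 _) (h0 _)).1 h1

theorem orderUnitNorm_mul_le (he : IsAlgUnit e) (x y : A) :
    orderUnitNorm (squares A) e (x * y) ≤
      orderUnitNorm (squares A) e x * orderUnitNorm (squares A) e y := by
  have hN := isNormFun_orderUnitNorm he
  set N := orderUnitNorm (squares A) e
  -- Polarize: 4ab = (a + b)² - (a - b)², and both squares lie between 0 and 4e.
  have unit_ball : ∀ a b : A, N a ≤ 1 → N b ≤ 1 → N (a * b) ≤ 1 := by
    intro a b ha hb
    refine (orderUnitNorm_squares_le_iff he _ zero_le_one).2 fun z => ?_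
    have hneg : N (-b) ≤ 1 := by
      rw [← neg_one_smul ℝ b, hN.smul]
      simpa using hb
    have bound : ∀ b : A, N b ≤ 1 →
        0 ≤ ⟪(a + b) * (a + b) * z, z⟫_ℝ ∧ ⟪(a + b) * (a + b) * z, z⟫_ℝ ≤ 4 * ‖z‖ ^ 2 := by
      intro b hb
      refine ⟨(mem_squares_iff he _).1 ⟨a + b, rfl⟩ z, (le_abs_self _).trans ?_⟩
      refine (abs_inner_mul_le he _ z).trans ?_
      rw [orderUnitNorm_mul_self he]
      have h1 : N (a + b) ≤ 2 := by linarith [hN.add_le a b]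
      have h2 : N (a + b) ^ 2 ≤ 4 := by nlinarith [hN.nonneg (a + b)]
      exact mul_le_mul_of_nonneg_right h2 (sq_nonneg _)
    obtain ⟨h1, h2⟩ := bound b hb
    obtain ⟨h3, h4⟩ := bound (-b) hneg
    have h5 : (4 : ℝ) • (a * b) = (a + b) * (a + b) - (a + -b) * (a + -b) := by
      simp only [mul_add, add_mul, mul_neg, neg_mul, mul_comm b a]
      module
    have h6 : 4 * ⟪a * b * z, z⟫_ℝ =
        ⟪(a + b) * (a + b) * z, z⟫_ℝ - ⟪(a + -b) * (a + -b) * z, z⟫_ℝ := by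
      rw [← inner_sub_left, ← sub_mul, ← h5, smul_mul_assoc, real_inner_smul_left]
    rw [abs_le]
    constructor <;> linarith
  have normalize : ∀ a : A, a ≠ 0 → N ((N a)⁻¹ • a) ≤ 1 := by
    intro a ha
    have h1 : N a ≠ 0 := fun h => ha ((hN.eq_zero_iff a).1 h)
    rw [hN.smul, abs_of_nonneg (inv_nonneg.2 (hN.nonneg a)), inv_mul_cancel₀ h1]
  have hN0 : N 0 = 0 := (hN.eq_zero_iff 0).2 rfl
  rcases eq_or_ne x 0 with rfl | hx
  · simp [hN0]
  rcases eq_or_ne y 0 with rfl | hy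
  · simp [hN0]
  have hxN : 0 < N x := lt_of_le_of_ne (hN.nonneg x) fun h => hx ((hN.eq_zero_iff x).1 h.symm)
  have hyN : 0 < N y := lt_of_le_of_ne (hN.nonneg y) fun h => hy ((hN.eq_zero_iff y).1 h.symm)
  have h := unit_ball _ _ (normalize x hx) (normalize y hy)
  rw [smul_mul_smul_comm, hN.smul, ← mul_inv, abs_of_pos (by positivity),
    inv_mul_le_iff₀ (by positivity), mul_one] at h
  exact h

theorem orderUnitNorm_mul_self_le_add (he : IsAlgUnit e) (x y : A) :
    orderUnitNorm (squares A) e (x * x) ≤ orderUnitNorm (squares A) e (x * x + y * y) := by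
  refine (orderUnitNorm_squares_le_iff he _ (orderUnitNorm_nonneg _ _ _)).2 fun z => ?_
  refine le_trans ?_ (abs_inner_mul_le he _ z)
  have hx := (mem_squares_iff he _).1 ⟨x, rfl⟩ z
  have hy := (mem_squares_iff he _).1 ⟨y, rfl⟩ z
  simp only at hx hy
  rw [add_mul, inner_add_left, abs_of_nonneg hx, abs_of_nonneg (add_nonneg hx hy)]
  exact le_add_of_nonneg_right hy

end OrderUnitNorm

theorem theoremT (A : Type*) [JHAlgebra A] (e : A) (he : IsAlgUnit e) :
    IsOrderUnitSpace (squares A) e ∧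
    AreEquivalentNorms (orderUnitNorm (squares A) e) (fun x : A => ‖x‖) ∧
    IsJBAlgebra A e (orderUnitNorm (squares A) e) :=
  ⟨⟨isProperCone_squares he, isArchimedeanCone_squares he, isOrderUnit_squares he⟩,
    areEquivalentNorms_orderUnitNorm he,
    ⟨he, isNormFun_orderUnitNorm he, isCompleteFun_orderUnitNorm he, orderUnitNorm_mul_le he,
      orderUnitNorm_mul_self he, orderUnitNorm_mul_self_le_add he⟩⟩
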